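/- Let $X$ be a complete metric space and let $S:[0,\infty)\times X\to X$ be a semiflow (continuous, $S(0)=\mathrm{id}$, $S(t+s)=S(t)S(s)$) that is asymptotically compact: if $(x_n)$ is bounded, $t_n\to+\infty$ and $(S(t_n)x_n)$ is bounded, then $(S(t_n)x_n)$ has a convergent subsequence. Let $\mathscr A$ be an attractor of $S$, that is, a nonempty compact set with $S(t)\mathscr A=\mathscr A$ for all $t\ge 0$ that attracts a neighborhood of itself, and let $\Omega=\{x: d(S(t)x,\mathscr A)\to 0 \text{ as } t\to\infty\}$ be its attraction basin. Let $M_1,\dots,M_l$ be a Morse decomposition of $\mathscr A$: there are $\emptyset=A_0\subsetneq A_1\subsetneq\cdots\subsetneq A_l=\mathscr A$, with $A_1,\dots,A_l$ attractors of the restriction of $S$ to $\mathscr A$, such that $M_k=A_k\cap\{x\in\mathscr A:\omega(x)\cap A_{k-1}=\emptyset\}$. Let $V:\Omega\to\mathbb R$ be a strict Morse-Lyapunov function: $V$ is continuous, $V\equiv c_k$ on $M_k$ with $c_1<c_2<\cdots<c_l$, and $V(S(t)x)<V(x)$ for all $t>0$ and $x\in\Omega\setminus\bigcup_k M_k$.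 Let $\tilde X$ be the quotient space of $X$ obtained by collapsing each $M_k$ to a point, with quotient map $q$, and for $r\in\mathbb R$ let $\tilde V_r=q(\{x\in\Omega: V(x)\le r\})$ with the subspace topology. Let $H_*$ be singular homology with coefficients in a module $G$ over an integral domain $R$, with ranks taken over $R$ (for $R=\mathbb Z$, $G$ is an arbitrary abelian group). For each $k$ choose $a_k<c_k<b_k$ such that $c_k$ is the only one of $c_1,\dots,c_l$ in $[a_k,b_k]$, and define the quotient critical groups $\tilde C_q(M_k)=H_q(\tilde V_{b_k},\tilde V_{a_k})$ and the quotient Morse type numbers $\tilde m_q=\sum_{k=1}^l\operatorname{rank}\tilde C_q(M_k)$. Let $\tilde\beta_q=\operatorname{rank}H_q(\tilde V_b)$ for some $b>c_l$. Assume that all the groups $\tilde C_q(M_k)$ ($1\le k\le l$, $q\ge 0$) have finite rank. Then every $\tilde\beta_q$ is finite, and for every $q\ge 0$ $$\tilde m_q-\tilde m_{q-1}+\cdots+(-1)^q\tilde m_0\ \ge\ \tilde\beta_q-\tilde\beta_{q-1}+\cdots+(-1)^q\tilde\beta_0 .$$ Moreover, if the series $\sum_{q=0}^\infty(-1)^q\tilde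 m_q$ converges, then so does $\sum_{q=0}^\infty(-1)^q\tilde\beta_q$, and $$\sum_{q=0}^\infty(-1)^q\tilde m_q=\sum_{q=0}^\infty(-1)^q\tilde\beta_q .$$ -/

import Mathlib

open Set Filter Topology
open scoped NNReal

universe u v

section Dynamics

variable {X : Type u} [MetricSpace X]

/-- A semiflow on `X` is a `Flow ℝ≥0 X`. It is asymptotically compact if, for every bounded sequence
`x n` and `t n → ∞` such that `S (t n) (x n)` is bounded, the sequence `S (t n) (x n)` has a
convergent subsequence. -/
def AsymptoticallyCompact (S : Flow ℝ≥0 X) : Prop :=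
  ∀ (x : ℕ → X) (t : ℕ → ℝ≥0), Bornology.IsBounded (range x) → Tendsto t atTop atTop →
    Bornology.IsBounded (range fun n => S (t n) (x n)) →
    ∃ (y : X) (φ : ℕ → ℕ), StrictMono φ ∧ Tendsto (fun n => S (t (φ n)) (x (φ n))) atTop (𝓝 y)

/-- `A` attracts `B`: for every `ε > 0` there is `T > 0` such that `S(t)B` is contained in the
`ε`-neighborhood of `A` for all `t > T`. -/
def Attracts (S : Flow ℝ≥0 X) (A B : Set X) : Prop :=
  ∀ ε : ℝ, 0 < ε → ∃ T : ℝ≥0, 0 < T ∧ ∀ t : ℝ≥0, T < t → S t '' B ⊆ Metric.thickening ε A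

/-- The attraction basin of `A`: all `x` with `d(S(t)x, A) → 0` as `t → ∞`. -/
def attractionBasin (S : Flow ℝ≥0 X) (A : Set X) : Set X :=
  {x | Tendsto (fun t : ℝ≥0 => Metric.infDist (S t x) A) atTop (𝓝 0)}

/-- `A` is a (nonempty) attractor of the restriction of `S` to the invariant set `Y`: it is a
compact subset of `Y`, it is invariant (`S(t)A = A` for all `t ≥ 0`), and it attracts a
neighborhood of itself relative to `Y`. -/
def IsAttractorIn (S : Flow ℝ≥0 X) (Y A : Set X) : Prop :=
  A.Nonempty ∧ A ⊆ Y ∧ IsCompact A ∧ (∀ t : ℝ≥0, S t '' A = A) ∧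
    ∃ U : Set X, IsOpen U ∧ A ⊆ U ∧ Attracts S A (U ∩ Y)

/-- `A` is a (nonempty) attractor of `S`. -/
def IsAttractor (S : Flow ℝ≥0 X) (A : Set X) : Prop :=
  IsAttractorIn S univ A

/-- The repeller `A^* = {x ∈ Y | ω(x) ∩ A = ∅}` dual to `A` in `Y`. -/
def dualRepeller (S : Flow ℝ≥0 X) (Y A : Set X) : Set X :=
  {x | x ∈ Y ∧ omegaLimit atTop S {x} ∩ A = ∅}

/-- `M 0, …, M (l - 1)` is a Morse decomposition of the attractor `𝒜`: there is a filtration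
`∅ = A 0 ⊊ A 1 ⊊ ⋯ ⊊ A l = 𝒜` by attractors of `S` in `𝒜` such that each `M k` is the intersection
of `A (k + 1)` with the repeller dual to `A k`. -/
def IsMorseDecomposition (S : Flow ℝ≥0 X) (𝒜 : Set X) {l : ℕ} (M : Fin l → Set X) : Prop :=
  ∃ A : Fin (l + 1) → Set X,
    A 0 = ∅ ∧ A (Fin.last l) = 𝒜 ∧
    (∀ k : Fin l, A k.castSucc ⊂ A k.succ) ∧
    (∀ k : Fin l, IsAttractorIn S 𝒜 (A k.succ)) ∧
    ∀ k : Fin l, M k = A k.succ ∩ dualRepeller S 𝒜 (A k.castSucc)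

/-- `V` is a strict Morse-Lyapunov function of the decomposition `M` on the attraction basin of `𝒜`,
with generalized critical values `c k = V (M k)`. Condition (2) says that `V` strictly decreases
along the trajectory as long as it has not entered a Morse set (where `V` is constant); a
trajectory of a semiflow may reach a Morse set in finite time. -/
structure IsStrictMorseLyapunov (S : Flow ℝ≥0 X) (𝒜 : Set X) {l : ℕ} (M : Fin l → Set X)
    (V : X → ℝ) (c : Fin l → ℝ) : Prop where
  continuousOn : ContinuousOn V (attractionBasin S 𝒜)
  const : ∀ k, ∀ x ∈ M k, V x = c k
  decreasing : ∀ x ∈ attractionBasin S 𝒜, x ∉ ⋃ k, M k → ∀ t : ℝ≥0, 0 < t → V (S t x) < V x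
  strict : StrictMono c

end Dynamics

section Quotient

variable {X : Type u}

/-- `x ∼ y` iff `x = y` or `x` and `y` belong to the same Morse set. -/
def morseRel {l : ℕ} (M : Fin l → Set X) (x y : X) : Prop :=
  x = y ∨ ∃ k, x ∈ M k ∧ y ∈ M k

/-- The quotient space `X̃ = X / ∼`, which carries the quotient topology
(`∼` is an equivalence relation for a Morse decomposition, see `morseRel_equivalence`). -/
abbrev MorseQuotient {l : ℕ} (M : Fin l → Set X) : Type u := Quot (morseRel M)

/-- Morse sets are pairwise disjoint, so that `∼` is an equivalence relation. -/
theorem morseRel_equivalence [MetricSpace X] {S : Flow ℝ≥0 X} {𝒜 : Set X} {l : ℕ}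
    {M : Fin l → Set X} (hM : IsMorseDecomposition S 𝒜 M) : Equivalence (morseRel M) := by
  obtain ⟨A, h0, -, hlt, hA, hMA⟩ := hM
  have hmono : StrictMono A := Fin.strictMono_iff_lt_succ.2 hlt
  have key : ∀ i j : Fin l, i < j → ∀ x, x ∈ M i → x ∈ M j → False := by
    intro i j hij x hi hj
    rw [hMA] at hi hj
    have hx : x ∈ A j.castSucc := hmono.monotone (Fin.succ_le_castSucc_iff.2 hij) hi.1
    have hne : j.castSucc ≠ 0 := by
      intro h
      rw [h, h0] at hx
      exact hx
    obtain ⟨m, hm⟩ := Fin.exists_succ_eq.2 hne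
    obtain ⟨-, -, hc, hinv, -⟩ := hA m
    rw [hm] at hc hinv
    have horb : ∀ t : ℝ≥0, S t x ∈ A j.castSucc := fun t => by
      have := mem_image_of_mem (S t) hx
      rwa [hinv t] at this
    obtain ⟨y, hy, hcl⟩ := hc.exists_mapClusterPt (f := atTop) (u := fun t : ℝ≥0 => S t x)
      (tendsto_principal.2 (Filter.Eventually.of_forall horb))
    have hy' : y ∈ omegaLimit atTop S {x} :=
      (mem_omegaLimit_singleton_iff_mapClusterPt _ _ _ _).2 hcl
    have := hj.2.2
    exact (this ▸ (⟨hy', hy⟩ : y ∈ omegaLimit atTop S {x} ∩ A j.castSucc) : y ∈ (∅ : Set X))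
  have hdisj : ∀ i j : Fin l, ∀ x, x ∈ M i → x ∈ M j → i = j := by
    intro i j x hi hj
    rcases lt_trichotomy i j with h | h | h
    · exact (key i j h x hi hj).elim
    · exact h
    · exact (key j i h x hj hi).elim
  refine ⟨fun x => Or.inl rfl, ?_, ?_⟩
  · rintro x y (rfl | ⟨k, hx, hy⟩)
    · exact Or.inl rfl
    · exact Or.inr ⟨k, hy, hx⟩
  · rintro x y z (rfl | ⟨k, hx, hy⟩) (rfl | ⟨m, hy', hz⟩)
    · exact Or.inl rfl
    · exact Or.inr ⟨m, hy', hz⟩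
    · exact Or.inr ⟨k, hx, hy⟩
    · obtain rfl := hdisj k m y hy hy'
      exact Or.inr ⟨k, hx, hz⟩

/-- The sublevel set `Ṽ_r = {[x] | x ∈ Ω(𝒜), V x ≤ r}` of the function `Ṽ[x] = V x` induced by `V`
on the image of the attraction basin in the quotient space. -/
def quotientSublevel [MetricSpace X] (S : Flow ℝ≥0 X) (𝒜 : Set X) {l : ℕ} (M : Fin l → Set X)
    (V : X → ℝ) (r : ℝ) : Set (MorseQuotient M) :=
  Quot.mk (morseRel M) '' {x | x ∈ attractionBasin S 𝒜 ∧ V x ≤ r}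

end Quotient

noncomputable section Homology

open CategoryTheory CategoryTheory.Limits AlgebraicTopology

variable (R : Type v) [CommRing R] (G : Type u) [AddCommGroup G] [Module R G]

/-- The singular homology `H_q(Y; G)` of a space `Y`, as an `R`-module. -/
def singularHomologyGroup (Y : Type u) [TopologicalSpace Y] (q : ℕ) : ModuleCat.{u} R :=
  ((singularHomologyFunctor (ModuleCat.{u} R) q).obj (ModuleCat.of R G)).obj (TopCat.of Y)

/-- The map of singular chain complexes `C(B; G) → C(Y; G)` induced by the inclusion `B ⊆ Y`. -/
def singularChainInclusion (Y : Type u) [TopologicalSpace Y] (B : Set Y) :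
    ((singularChainComplexFunctor (ModuleCat.{u} R)).obj (ModuleCat.of R G)).obj (TopCat.of B) ⟶
      ((singularChainComplexFunctor (ModuleCat.{u} R)).obj (ModuleCat.of R G)).obj (TopCat.of Y) :=
  ((singularChainComplexFunctor (ModuleCat.{u} R)).obj (ModuleCat.of R G)).map
    (TopCat.ofHom ⟨Subtype.val, continuous_subtype_val⟩)

/-- The relative singular homology `H_q(Y, B; G)` of a pair `B ⊆ Y`: the homology of the quotient
complex `C(Y; G) / C(B; G)`. -/
def relativeSingularHomology (Y : Type u) [TopologicalSpace Y] (B : Set Y) (q : ℕ) :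
    ModuleCat.{u} R :=
  (cokernel (singularChainInclusion R G Y B)).homology q

variable {X : Type u} [MetricSpace X] (S : Flow ℝ≥0 X) (𝒜 : Set X) {l : ℕ} (M : Fin l → Set X)
  (V : X → ℝ)

/-- `H_q(Ṽ_b, Ṽ_a; G)`. When `a < c k < b` and `c k` is the only generalized critical value of `V`
in `[a, b]`, this is the `q`-th quotient critical group of the Morse set `M k`. -/
def quotientCriticalGroup (a b : ℝ) (q : ℕ) : ModuleCat.{u} R :=
  relativeSingularHomology R G (quotientSublevel S 𝒜 M V b)
    (Subtype.val ⁻¹' quotientSublevel S 𝒜 M V a) q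

/-- The quotient Morse type number `m̃_q = ∑ k, rank C̃_q(M k)`, where the critical group of `M k` is
computed with the interval `[a k, b k]`. -/
def quotientMorseTypeNumber (a b : Fin l → ℝ) (q : ℕ) : ℕ :=
  ∑ k : Fin l, Module.finrank R (quotientCriticalGroup R G S 𝒜 M V (a k) (b k) q)

/-- The quotient Betti number `β̃_q = rank H_q(Ṽ_b; G)` (for `b` above all critical values). -/
def quotientBettiNumber (b : ℝ) (q : ℕ) : ℕ :=
  Module.finrank R (singularHomologyGroup R G (quotientSublevel S 𝒜 M V b) q)

end Homology

/-! ### Additivity of rank along exact sequences. -/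

section ExactSequence

open Cardinal

variable {R : Type v} [CommRing R] [IsDomain R]

/-! The homology of `Ṽ_r` can change only when `r` crosses some `c k`. Along a trajectory in the
basin, `V` decreases to a critical value (`exists_tendsto`), so if `[a, b]` contains none, every
trajectory starting in `{V ≤ b}` gets below `a`. A partition of unity makes the descent time
continuous, and flowing for that time deforms the upper sublevel set into the lower one. The
deformation passes to the quotient because Morse sets are forward invariant, and it stays continuous
because the quotient map is proper (`nonempty_homotopyEquiv_quotientSublevel`).

The pairs `(Ṽ_{b k}, Ṽ_{a k})` therefore form a chain: homologically, each begins where the previous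
one ends, the first begins with the empty set and the last ends with `Ṽ_{b'}`. Counting ranks in
their long exact sequences and summing over `k` telescopes to `m_q = E_{q-1} + β_q + E_q`, where
`E_q ≥ 0` is the total rank of the connecting maps into degree `q` (`exists_rank_relations`).
Alternating sums of `m` and `β` then differ only by `E_q`, which gives the inequalities; if the
series for `m` converges, its integer terms eventually vanish, and so does `E`. -/

/-- In an exact sequence `A → B → C` of modules over a domain, the rank of `B` is the sum of the
ranks of the two images. -/
theorem rank_eq_rank_range_add_rank_range {A B C : Type u} [AddCommGroup A] [AddCommGroup B]
    [AddCommGroup C] [Module R A] [Module R B] [Module R C] (f : A →ₗ[R] B) (g : B →ₗ[R] C)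
    (h : LinearMap.range f = LinearMap.ker g) :
    Module.rank R B = Module.rank R (LinearMap.range f) + Module.rank R (LinearMap.range g) := by
  rw [h, add_comm, LinearMap.rank_range_add_rank_ker]

/-- `finrank` is 0 on modules of infinite rank, so additivity in `ℕ` needs finiteness. -/
theorem finrank_eq_finrank_range_add_finrank_range {A B C : Type u} [AddCommGroup A]
    [AddCommGroup B] [AddCommGroup C] [Module R A] [Module R B] [Module R C]
    (f : A →ₗ[R] B) (g : B →ₗ[R] C) (h : LinearMap.range f = LinearMap.ker g)
    (hB : Module.rank R B < ℵ₀) :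
    Module.finrank R B =
      Module.finrank R (LinearMap.range f) + Module.finrank R (LinearMap.range g) := by
  have hr := rank_eq_rank_range_add_rank_range f g h
  rw [hr, Cardinal.add_lt_aleph0_iff] at hB
  simp only [Module.finrank, hr, Cardinal.toNat_add hB.1 hB.2]

theorem rank_lt_aleph0_of_exact {A B C : Type u} [AddCommGroup A]
    [AddCommGroup B] [AddCommGroup C] [Module R A] [Module R B] [Module R C]
    (f : A →ₗ[R] B) (g : B →ₗ[R] C) (h : LinearMap.range f = LinearMap.ker g)
    (hA : Module.rank R A < ℵ₀) (hC : Module.rank R C < ℵ₀) : Module.rank R B < ℵ₀ := by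
  rw [rank_eq_rank_range_add_rank_range f g h]
  exact Cardinal.add_lt_aleph0 ((rank_range_le f).trans_lt hA)
    ((Submodule.rank_le _).trans_lt hC)

end ExactSequence

/-! ### Singular homology of pairs. -/

noncomputable section Homology

open CategoryTheory CategoryTheory.Limits AlgebraicTopology Cardinal

variable (R : Type v) [CommRing R] (G : Type u) [AddCommGroup G] [Module R G]

/-- Homotopy equivalent spaces have isomorphic singular homology. -/
theorem nonempty_iso_singularHomologyGroup {Y Z : Type u} [TopologicalSpace Y] [TopologicalSpace Z]
    (e : ContinuousMap.HomotopyEquiv Y Z) (q : ℕ) :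
    Nonempty (singularHomologyGroup R G Y q ≅ singularHomologyGroup R G Z q) := by
  let F := (singularHomologyFunctor (ModuleCat.{u} R) q).obj (ModuleCat.of R G)
  obtain ⟨H₁⟩ := e.left_inv
  obtain ⟨H₂⟩ := e.right_inv
  have h₁ : F.map (TopCat.ofHom e.toFun ≫ TopCat.ofHom e.invFun) = F.map (𝟙 (TopCat.of Y)) :=
    TopCat.Homotopy.congr_homologyMap_singularChainComplexFunctor
      (f := TopCat.ofHom e.toFun ≫ TopCat.ofHom e.invFun) (g := 𝟙 (TopCat.of Y)) H₁ _ _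
  have h₂ : F.map (TopCat.ofHom e.invFun ≫ TopCat.ofHom e.toFun) = F.map (𝟙 (TopCat.of Z)) :=
    TopCat.Homotopy.congr_homologyMap_singularChainComplexFunctor
      (f := TopCat.ofHom e.invFun ≫ TopCat.ofHom e.toFun) (g := 𝟙 (TopCat.of Z)) H₂ _ _
  rw [F.map_comp, F.map_id] at h₁ h₂
  exact ⟨⟨F.map (TopCat.ofHom e.toFun), F.map (TopCat.ofHom e.invFun), h₁, h₂⟩⟩

/-- The start of the telescoping. An empty space is totally disconnected, so its homology is
concentrated in degree 0, where it is a coproduct over no points. -/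
theorem rank_singularHomologyGroup_of_isEmpty [Nontrivial R] (Y : Type u) [TopologicalSpace Y]
    [IsEmpty Y] (q : ℕ) : Module.rank R (singularHomologyGroup R G Y q) = 0 := by
  have hz : IsZero (singularHomologyGroup R G Y q) := by
    have : IsEmpty (TopCat.of Y) := ‹IsEmpty Y›
    have : TotallyDisconnectedSpace (TopCat.of Y) := ⟨fun t _ _ x => isEmptyElim x⟩
    rcases eq_or_ne q 0 with rfl | hq
    · refine IsZero.of_iso ?_ (singularHomologyFunctorZeroOfTotallyDisconnectedSpace
        (ModuleCat.{u} R) (ModuleCat.of R G) (TopCat.of Y))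
      rw [IsZero.iff_id_eq_zero]
      exact Sigma.hom_ext _ _ fun x => isEmptyElim x
    · exact isZero_singularHomologyFunctor_of_totallyDisconnectedSpace _ _ _ _ hq
  have := ModuleCat.subsingleton_of_isZero hz
  exact rank_subsingleton' R _

variable (Y : Type u) [TopologicalSpace Y] (B : Set Y)

/-- The short exact sequence `0 → C(B) → C(Y) → C(Y, B) → 0`. -/
def singularPairSequence : ShortComplex (ChainComplex (ModuleCat.{u} R) ℕ) :=
  ShortComplex.mk (singularChainInclusion R G Y B) (cokernel.π _) (cokernel.condition _)

theorem singularPairSequence_shortExact : (singularPairSequence R G Y B).ShortExact := by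
  have hm : Mono (TopCat.ofHom (⟨Subtype.val, continuous_subtype_val⟩ : C(B, Y))) :=
    (TopCat.mono_iff_injective _).2 Subtype.val_injective
  have : Mono (singularPairSequence R G Y B).f := by
    dsimp [singularPairSequence, singularChainInclusion]
    infer_instance
  have : Epi (singularPairSequence R G Y B).g := by
    dsimp [singularPairSequence]
    infer_instance
  exact { exact := ShortComplex.exact_cokernel _ }

theorem rank_singularHomologyGroup_lt_aleph0 [IsDomain R] (q : ℕ)
    (hB : Module.rank R (singularHomologyGroup R G B q) < ℵ₀)
    (hrel : Module.rank R (relativeSingularHomology R G Y B q) < ℵ₀) :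
    Module.rank R (singularHomologyGroup R G Y q) < ℵ₀ :=
  rank_lt_aleph0_of_exact _ _
    ((singularPairSequence_shortExact R G Y B).homology_exact₂ q).moduleCat_range_eq_ker hB hrel

/-- Rank count in the long exact homology sequence of a pair; `d q` is the rank of the connecting
homomorphism `H_{q+1}(Y, B) → H_q(B)`. -/
theorem exists_rank_connecting [IsDomain R]
    (hB : ∀ q, Module.rank R (singularHomologyGroup R G B q) < ℵ₀)
    (hrel : ∀ q, Module.rank R (relativeSingularHomology R G Y B q) < ℵ₀) :
    ∃ d : ℕ → ℕ,
      Module.finrank R (relativeSingularHomology R G Y B 0) +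
          Module.finrank R (singularHomologyGroup R G B 0) =
        Module.finrank R (singularHomologyGroup R G Y 0) + d 0 ∧
      ∀ q, Module.finrank R (relativeSingularHomology R G Y B (q + 1)) +
          Module.finrank R (singularHomologyGroup R G B (q + 1)) =
        d q + Module.finrank R (singularHomologyGroup R G Y (q + 1)) + d (q + 1) := by
  have hS := singularPairSequence_shortExact R G Y B
  have hrel_succ : ∀ q : ℕ, (ComplexShape.down ℕ).Rel (q + 1) q := fun q => rfl
  have hY := fun q => rank_singularHomologyGroup_lt_aleph0 R G Y B q (hB q) (hrel q)
  let f := fun q => (HomologicalComplex.homologyMap (singularPairSequence R G Y B).f q).hom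
  let g := fun q => (HomologicalComplex.homologyMap (singularPairSequence R G Y B).g q).hom
  let δ := fun q => (hS.δ (q + 1) q (hrel_succ q)).hom
  have e₁ : ∀ q, Module.finrank R (singularHomologyGroup R G B q) =
      Module.finrank R (LinearMap.range (δ q)) + Module.finrank R (LinearMap.range (f q)) :=
    fun q => finrank_eq_finrank_range_add_finrank_range _ _
      (hS.homology_exact₁ (q + 1) q (hrel_succ q)).moduleCat_range_eq_ker (hB q)
  have e₂ : ∀ q, Module.finrank R (singularHomologyGroup R G Y q) =
      Module.finrank R (LinearMap.range (f q)) + Module.finrank R (LinearMap.range (g q)) :=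
    fun q => finrank_eq_finrank_range_add_finrank_range _ _
      (hS.homology_exact₂ q).moduleCat_range_eq_ker (hY q)
  have e₃ : ∀ q, Module.finrank R (relativeSingularHomology R G Y B (q + 1)) =
      Module.finrank R (LinearMap.range (g (q + 1))) + Module.finrank R (LinearMap.range (δ q)) :=
    fun q => finrank_eq_finrank_range_add_finrank_range _ _
      (hS.homology_exact₃ (q + 1) q (hrel_succ q)).moduleCat_range_eq_ker (hrel (q + 1))
  -- There is no connecting map out of degree 0, so `H_0(Y) → H_0(Y, B)` is onto.
  have e₀ : Module.finrank R (relativeSingularHomology R G Y B 0) =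
      Module.finrank R (LinearMap.range (g 0)) := by
    have := hS.epi_g
    have : Epi (HomologicalComplex.homologyMap (singularPairSequence R G Y B).g 0) :=
      HomologicalComplex.epi_homologyMap_of_epi_of_not_rel _ _ (by simp)
    have hs : LinearMap.range (g 0) = ⊤ :=
      LinearMap.range_eq_top.2 ((ModuleCat.epi_iff_surjective _).1 this)
    rw [hs, finrank_top]
    rfl
  refine ⟨fun q => Module.finrank R (LinearMap.range (δ q)), ?_, fun q => ?_⟩
  · have := e₁ 0
    have := e₂ 0
    dsimp only
    omega
  · have := e₁ (q + 1)
    have := e₂ (q + 1)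
    have := e₃ q
    dsimp only
    omega

end Homology

/-! ### Arithmetic of alternating sums. -/

section AlternatingSums

/-- The Morse inequalities and the Morse equation for sequences of ranks, `E q` being the total rank
of the connecting homomorphisms from degree `q + 1` to degree `q`. -/
theorem alternating_sum_eq (m β E : ℕ → ℕ) (h0 : m 0 = β 0 + E 0)
    (hsucc : ∀ q, m (q + 1) = E q + β (q + 1) + E (q + 1)) (q : ℕ) :
    ∑ j ∈ Finset.range (q + 1), (-1 : ℤ) ^ j * (m j : ℤ) =
      ∑ j ∈ Finset.range (q + 1), (-1 : ℤ) ^ j * (β j : ℤ) + (-1) ^ q * E q := by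
  induction q with
  | zero => simp [h0]
  | succ q ih =>
    rw [Finset.sum_range_succ, ih, Finset.sum_range_succ _ (q + 1), hsucc]
    push_cast
    ring

theorem alternating_sum_le (m β E : ℕ → ℕ) (h0 : m 0 = β 0 + E 0)
    (hsucc : ∀ q, m (q + 1) = E q + β (q + 1) + E (q + 1)) (q : ℕ) :
    ∑ j ∈ Finset.range (q + 1), (-1 : ℤ) ^ (q - j) * (β j : ℤ) ≤
      ∑ j ∈ Finset.range (q + 1), (-1 : ℤ) ^ (q - j) * (m j : ℤ) := by
  have key : ∀ f : ℕ → ℕ, ∑ j ∈ Finset.range (q + 1), (-1 : ℤ) ^ (q - j) * (f j : ℤ) =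
      (-1) ^ q * ∑ j ∈ Finset.range (q + 1), (-1 : ℤ) ^ j * (f j : ℤ) := by
    intro f
    rw [Finset.mul_sum]
    refine Finset.sum_congr rfl fun j hj => ?_
    obtain ⟨i, rfl⟩ := Nat.exists_eq_add_of_le (Nat.lt_succ_iff.1 (Finset.mem_range.1 hj))
    have h1 : (-1 : ℤ) ^ j * (-1) ^ j = 1 := by rw [← mul_pow]; simp
    rw [Nat.add_sub_cancel_left, pow_add]
    linear_combination (-(-1) ^ i * (f j : ℤ)) * h1
  rw [key, key, alternating_sum_eq m β E h0 hsucc, mul_add, ← mul_assoc, ← mul_pow]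
  simp

theorem tendsto_alternating_sum (m β E : ℕ → ℕ) (h0 : m 0 = β 0 + E 0)
    (hsucc : ∀ q, m (q + 1) = E q + β (q + 1) + E (q + 1)) {s : ℝ}
    (hs : Tendsto (fun n : ℕ => ∑ q ∈ Finset.range n, (-1 : ℝ) ^ q * (m q : ℝ)) atTop (𝓝 s)) :
    Tendsto (fun n : ℕ => ∑ q ∈ Finset.range n, (-1 : ℝ) ^ q * (β q : ℝ)) atTop (𝓝 s) := by
  have hterm : Tendsto (fun n : ℕ => (-1 : ℝ) ^ n * (m n : ℝ)) atTop (𝓝 0) := by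
    have := (hs.comp (tendsto_add_atTop_nat 1)).sub hs
    simpa [Function.comp_def, Finset.sum_range_succ] using this
  -- The terms are integers up to sign and tend to 0.
  have hm : ∀ᶠ n in atTop, m n = 0 := by
    have := hterm.abs.eventually (gt_mem_nhds (show |(0 : ℝ)| < 1 by simp))
    filter_upwards [this] with n hn
    simpa [abs_mul] using hn
  refine hs.congr' ?_
  filter_upwards [hm, eventually_gt_atTop 0] with n hn hpos
  obtain ⟨q, rfl⟩ := Nat.exists_eq_succ_of_ne_zero hpos.ne'
  -- `E q` is a summand of `m (q + 1) = 0`, so the error term of this partial sum vanishes.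
  have hE : E q = 0 := by
    have := hn.symm.trans (hsucc q)
    omega
  have := alternating_sum_eq m β E h0 hsucc q
  rw [hE] at this
  simp only [Nat.cast_zero, mul_zero, add_zero] at this
  exact_mod_cast congrArg (Int.cast : ℤ → ℝ) this

end AlternatingSums

/-! ### Trajectories, Morse sets and the Lyapunov function. -/

section Dynamics

variable {X : Type u} [MetricSpace X] {S : Flow ℝ≥0 X}

/-- A function approaching a compact set along a filter has a cluster point in it. -/
theorem IsCompact.exists_mapClusterPt_of_tendsto_infDist {α : Type*} {A : Set X}
    (hA : IsCompact A) (hne : A.Nonempty) {L : Filter α} [L.NeBot] {u : α → X}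
    (hu : Tendsto (fun t => Metric.infDist (u t) A) L (𝓝 0)) : ∃ y ∈ A, MapClusterPt y L u := by
  -- Nearest points in `A` cluster by compactness, and `u` is asymptotic to them.
  choose p hpA hp using fun t => hA.exists_infDist_eq_dist hne (u t)
  obtain ⟨y, hy, hcl⟩ := hA.exists_mapClusterPt (f := L) (u := p)
    (tendsto_principal.2 (Eventually.of_forall hpA))
  obtain ⟨U, hU, hpU⟩ := mapClusterPt_iff_ultrafilter.1 hcl
  refine ⟨y, hy, mapClusterPt_iff_ultrafilter.2 ⟨U, hU, ?_⟩⟩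
  refine (tendsto_iff_of_dist ?_).2 hpU
  simpa only [hp] using hu.mono_left hU

theorem NNReal.tendsto_add_const_atTop (s : ℝ≥0) :
    Tendsto (fun t : ℝ≥0 => t + s) atTop atTop :=
  tendsto_atTop_mono (fun _ => le_self_add) tendsto_id

theorem flow_mem_attractionBasin {A : Set X} {x : X} (hx : x ∈ attractionBasin S A) (s : ℝ≥0) :
    S s x ∈ attractionBasin S A := by
  have hx' : Tendsto (fun t : ℝ≥0 => Metric.infDist (S t x) A) atTop (𝓝 0) := hx
  have := hx'.comp (NNReal.tendsto_add_const_atTop s)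
  simpa only [attractionBasin, mem_ofPred_eq, Function.comp_def, Flow.map_add] using this

theorem subset_attractionBasin {A : Set X} (hA : ∀ t : ℝ≥0, S t '' A = A) :
    A ⊆ attractionBasin S A := by
  intro x hx
  have : ∀ t : ℝ≥0, Metric.infDist (S t x) A = 0 := fun t =>
    Metric.infDist_zero_of_mem (hA t ▸ mem_image_of_mem _ hx)
  simp only [attractionBasin, mem_ofPred_eq, this, tendsto_const_nhds]

theorem Attracts.tendsto_infDist {A B : Set X} (h : Attracts S A B) {x : X} (hx : x ∈ B) :
    Tendsto (fun t : ℝ≥0 => Metric.infDist (S t x) A) atTop (𝓝 0) := by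
  rw [Metric.tendsto_atTop']
  intro ε hε
  obtain ⟨T, -, hT⟩ := h ε hε
  refine ⟨T, fun t ht => ?_⟩
  have hmem := hT t ht (mem_image_of_mem _ hx)
  obtain ⟨z, hz, hd⟩ := Metric.mem_thickening_iff.1 hmem
  rw [Real.dist_0_eq_abs, abs_of_nonneg Metric.infDist_nonneg]
  exact (Metric.infDist_le_dist_of_mem hz).trans_lt hd

theorem omegaLimit_flow_subset (x : X) (s : ℝ≥0) :
    omegaLimit atTop S {S s x} ⊆ omegaLimit atTop S {x} := by
  intro y hy
  rw [mem_omegaLimit_singleton_iff_mapClusterPt] at hy ⊢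
  simp only [← Flow.map_add] at hy
  exact MapClusterPt.of_comp (φ := fun t : ℝ≥0 => t + s)
    (NNReal.tendsto_add_const_atTop s) hy

theorem flow_mem_dualRepeller {Y A : Set X} (hY : ∀ t : ℝ≥0, S t '' Y = Y) {x : X}
    (hx : x ∈ dualRepeller S Y A) (t : ℝ≥0) : S t x ∈ dualRepeller S Y A :=
  ⟨hY t ▸ mem_image_of_mem _ hx.1, subset_empty_iff.1 <|
    (inter_subset_inter_left _ (omegaLimit_flow_subset x t)).trans hx.2.subset⟩

/-- If the limit set of a limit point `x` met `A`, the orbit of `x` would enter the attracted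
neighborhood `U`. By continuity so would that of a nearby repeller point `z`, whose limit set would
then meet `A`. -/
theorem isClosed_dualRepeller {Y A : Set X} (hY : ∀ t : ℝ≥0, S t '' Y = Y) (hYc : IsClosed Y)
    (hA : IsAttractorIn S Y A) : IsClosed (dualRepeller S Y A) := by
  obtain ⟨hne, -, hc, -, U, hU, hAU, hatt⟩ := hA
  refine isClosed_of_closure_subset fun x hx => ?_
  have hxY : x ∈ Y := closure_minimal (fun z hz => hz.1) hYc hx
  refine ⟨hxY, eq_empty_iff_forall_notMem.2 fun y ⟨hy, hyA⟩ => ?_⟩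
  rw [mem_omegaLimit_singleton_iff_mapClusterPt, mapClusterPt_iff_frequently] at hy
  obtain ⟨t, ht⟩ := (hy U (hU.mem_nhds (hAU hyA))).exists
  obtain ⟨z, hzU, hz⟩ := mem_closure_iff.1 hx _ (hU.preimage (S.continuous_toFun t)) ht
  have hz' := flow_mem_dualRepeller hY hz t
  obtain ⟨w, hwA, hw⟩ :=
    hc.exists_mapClusterPt_of_tendsto_infDist hne (hatt.tendsto_infDist ⟨hzU, hz'.1⟩)
  exact eq_empty_iff_forall_notMem.1 hz'.2 w
    ⟨(mem_omegaLimit_singleton_iff_mapClusterPt _ _ _ _).2 hw, hwA⟩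

variable {𝒜 : Set X} {l : ℕ} {M : Fin l → Set X} {V : X → ℝ} {c : Fin l → ℝ}

theorem IsMorseDecomposition.subset (hM : IsMorseDecomposition S 𝒜 M) (k : Fin l) : M k ⊆ 𝒜 := by
  obtain ⟨A, -, -, -, -, hMA⟩ := hM
  exact fun x hx => (hMA k ▸ hx).2.1

theorem IsMorseDecomposition.flow_mem (h𝒜 : IsAttractor S 𝒜) (hM : IsMorseDecomposition S 𝒜 M)
    {k : Fin l} {x : X} (hx : x ∈ M k) (t : ℝ≥0) : S t x ∈ M k := by
  obtain ⟨A, -, -, -, hA, hMA⟩ := hM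
  rw [hMA] at hx ⊢
  exact ⟨(hA k).2.2.2.1 t ▸ mem_image_of_mem _ hx.1, flow_mem_dualRepeller h𝒜.2.2.2.1 hx.2 t⟩

theorem IsMorseDecomposition.isCompact (h𝒜 : IsAttractor S 𝒜) (hM : IsMorseDecomposition S 𝒜 M)
    (k : Fin l) : IsCompact (M k) := by
  obtain ⟨A, h0, -, -, hA, hMA⟩ := hM
  rw [hMA]
  refine (hA k).2.2.1.inter_right ?_
  -- The bottom set `A 0 = ∅` is not an attractor; its dual repeller is all of `𝒜`.
  rcases Fin.eq_zero_or_eq_succ k.castSucc with h | ⟨j, hj⟩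
  · rw [h, h0]
    simpa [dualRepeller] using h𝒜.2.2.1.isClosed
  · rw [hj]
    exact isClosed_dualRepeller h𝒜.2.2.2.1 h𝒜.2.2.1.isClosed (hA j)

theorem IsStrictMorseLyapunov.le_of_flow (hV : IsStrictMorseLyapunov S 𝒜 M V c)
    (h𝒜 : IsAttractor S 𝒜) (hM : IsMorseDecomposition S 𝒜 M) {x : X}
    (hx : x ∈ attractionBasin S 𝒜) (t : ℝ≥0) : V (S t x) ≤ V x := by
  by_cases hxM : x ∈ ⋃ k, M k
  · obtain ⟨k, hk⟩ := mem_iUnion.1 hxM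
    rw [hV.const k x hk, hV.const k _ (hM.flow_mem h𝒜 hk t)]
  · rcases eq_or_ne t 0 with rfl | ht
    · simp
    · exact (hV.decreasing x hx hxM t (pos_iff_ne_zero.2 ht)).le

theorem IsStrictMorseLyapunov.antitone (hV : IsStrictMorseLyapunov S 𝒜 M V c)
    (h𝒜 : IsAttractor S 𝒜) (hM : IsMorseDecomposition S 𝒜 M) {x : X}
    (hx : x ∈ attractionBasin S 𝒜) : Antitone fun t => V (S t x) := by
  intro s t hst
  obtain ⟨r, rfl⟩ := exists_add_of_le hst
  simp only [add_comm s r, Flow.map_add]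
  exact hV.le_of_flow h𝒜 hM (flow_mem_attractionBasin hx s) r

/-- Along a trajectory in the attraction basin, `V` decreases to a generalized critical value. -/
theorem IsStrictMorseLyapunov.exists_tendsto (hV : IsStrictMorseLyapunov S 𝒜 M V c)
    (h𝒜 : IsAttractor S 𝒜) (hM : IsMorseDecomposition S 𝒜 M) {x : X}
    (hx : x ∈ attractionBasin S 𝒜) :
    ∃ k, c k ≤ V x ∧ Tendsto (fun t => V (S t x)) atTop (𝓝 (c k)) := by
  obtain ⟨y, hy, hcl⟩ :=
    h𝒜.2.2.1.exists_mapClusterPt_of_tendsto_infDist (u := fun t => S t x) h𝒜.1 hx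
  obtain ⟨U, hU, hyU⟩ := mapClusterPt_iff_ultrafilter.1 hcl
  have hΩ := subset_attractionBasin h𝒜.2.2.2.1
  have hanti := hV.antitone h𝒜 hM hx
  have hlim : ∀ s : ℝ≥0, Tendsto (fun t => V (S s (S t x))) U (𝓝 (V (S s y))) := fun s =>
    (hV.continuousOn _ (flow_mem_attractionBasin (hΩ hy) s)).tendsto.comp
      (tendsto_nhdsWithin_iff.2 ⟨((S.continuous_toFun s).tendsto y).comp hyU,
        Eventually.of_forall fun t =>
          flow_mem_attractionBasin (flow_mem_attractionBasin hx t) s⟩)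
  have hlim₀ : Tendsto (fun t => V (S t x)) U (𝓝 (V y)) := by simpa using hlim 0
  have hbdd : ∀ t, V y ≤ V (S t x) := fun t =>
    le_of_tendsto hlim₀ (hU ((eventually_ge_atTop t).mono fun s hs => hanti hs))
  have hconv : Tendsto (fun t => V (S t x)) atTop (𝓝 (V y)) := by
    have h := tendsto_atTop_ciInf hanti ⟨V y, forall_mem_range.2 hbdd⟩
    rwa [tendsto_nhds_unique hlim₀ (h.mono_left hU)]
  -- LaSalle's argument: along `U`, the values `V (S 1 (S t x))` tend both to `V (S 1 y)` and to the
  -- limit `V y`, so `V` does not drop at `y`.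
  have hyM : y ∈ ⋃ k, M k := by
    by_contra hyM
    refine (hV.decreasing y (hΩ hy) hyM 1 one_pos).ne (tendsto_nhds_unique (hlim 1) ?_)
    have := (hconv.comp (NNReal.tendsto_add_const_atTop 1)).mono_left hU
    simpa only [Function.comp_def, add_comm _ (1 : ℝ≥0), Flow.map_add] using this
  obtain ⟨k, hk⟩ := mem_iUnion.1 hyM
  refine ⟨k, ?_⟩
  rw [← hV.const k y hk]
  exact ⟨by simpa using hbdd 0, hconv⟩

theorem IsStrictMorseLyapunov.exists_flow_lt (hV : IsStrictMorseLyapunov S 𝒜 M V c)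
    (h𝒜 : IsAttractor S 𝒜) (hM : IsMorseDecomposition S 𝒜 M) {x : X} {a : ℝ}
    (hx : x ∈ attractionBasin S 𝒜) (ha : ∀ k, c k ∉ Icc a (V x)) : ∃ t, V (S t x) < a := by
  obtain ⟨k, hk, hlim⟩ := hV.exists_tendsto h𝒜 hM hx
  exact (hlim.eventually_lt_const (not_le.1 fun h => ha k ⟨h, hk⟩)).exists

end Dynamics

/-! ### Deforming sublevel sets in the quotient. -/

section Deformation

open scoped unitInterval

/-- A subset `P ⊆ Q` into which `Q` can be deformed within `Q`, the deformation preserving `P`, is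
homotopy equivalent to `Q`. -/
theorem nonempty_homotopyEquiv_of_deformation {Z : Type u} [TopologicalSpace Z] {P Q : Set Z}
    (hPQ : P ⊆ Q) (H : C(I × Q, Q)) (h₀ : ∀ z, H (0, z) = z) (h₁ : ∀ z, (H (1, z) : Z) ∈ P)
    (hP : ∀ s (z : Q), (z : Z) ∈ P → (H (s, z) : Z) ∈ P) :
    Nonempty (ContinuousMap.HomotopyEquiv P Q) := by
  let i : C(P, Q) := ⟨inclusion hPQ, continuous_inclusion hPQ⟩
  let r : C(Q, P) := ⟨fun z => ⟨H (1, z), h₁ z⟩, by fun_prop⟩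
  refine ⟨⟨i, r, .symm ⟨⟨⟨fun p => ⟨H (p.1, i p.2), hP _ _ p.2.2⟩, by fun_prop⟩, ?_, ?_⟩⟩,
    .symm ⟨⟨H, ?_, ?_⟩⟩⟩⟩
  · intro z
    exact Subtype.ext (congrArg Subtype.val (h₀ (i z)) :)
  · intro z
    rfl
  · exact h₀
  · intro z
    rfl

variable {X : Type u} [MetricSpace X] {S : Flow ℝ≥0 X}
  {𝒜 : Set X} {l : ℕ} {M : Fin l → Set X} {V : X → ℝ} {c : Fin l → ℝ}

theorem IsMorseDecomposition.mk_eq_mk_iff (hM : IsMorseDecomposition S 𝒜 M) {x y : X} :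
    Quot.mk (morseRel M) x = Quot.mk (morseRel M) y ↔ morseRel M x y :=
  Quot.eq.trans (morseRel_equivalence hM).eqvGen_iff

theorem IsMorseDecomposition.preimage_image_mk (hM : IsMorseDecomposition S 𝒜 M) (F : Set X) :
    Quot.mk (morseRel M) ⁻¹' (Quot.mk (morseRel M) '' F) =
      F ∪ ⋃ k ∈ {k | (M k ∩ F).Nonempty}, M k := by
  ext x
  simp only [mem_preimage, mem_image, hM.mk_eq_mk_iff, mem_union, mem_iUnion, mem_ofPred_eq,
    exists_prop]
  constructor
  · rintro ⟨y, hy, rfl | ⟨k, hyk, hxk⟩⟩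
    · exact Or.inl hy
    · exact Or.inr ⟨k, ⟨y, hyk, hy⟩, hxk⟩
  · rintro (hx | ⟨k, ⟨y, hyk, hy⟩, hxk⟩)
    · exact ⟨x, hx, Or.inl rfl⟩
    · exact ⟨y, hy, Or.inr ⟨k, hyk, hxk⟩⟩

/-- Saturating a closed set adds only finitely many compact Morse sets. -/
theorem IsMorseDecomposition.isClosedMap_mk (h𝒜 : IsAttractor S 𝒜)
    (hM : IsMorseDecomposition S 𝒜 M) : IsClosedMap (Quot.mk (morseRel M)) := by
  intro F hF
  rw [← isQuotientMap_quot_mk.isClosed_preimage, hM.preimage_image_mk]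
  exact hF.union ((toFinite _).isClosed_biUnion fun k _ => (hM.isCompact h𝒜 k).isClosed)

/-- The quotient map is proper over every subset of the quotient. -/
theorem IsMorseDecomposition.isProperMap_restrictPreimage (h𝒜 : IsAttractor S 𝒜)
    (hM : IsMorseDecomposition S 𝒜 M) (B : Set (MorseQuotient M)) :
    IsProperMap (B.restrictPreimage (Quot.mk (morseRel M))) := by
  refine isProperMap_iff_isClosedMap_and_compact_fibers.2
    ⟨continuous_quot_mk.restrictPreimage, (hM.isClosedMap_mk h𝒜).restrictPreimage B, ?_⟩
  rintro ⟨⟨x⟩, hx⟩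
  have hc : IsCompact (Quot.mk (morseRel M) ⁻¹' {Quot.mk (morseRel M) x}) := by
    rw [← image_singleton, hM.preimage_image_mk]
    exact isCompact_singleton.union ((toFinite _).isCompact_biUnion fun k _ => hM.isCompact h𝒜 k)
  rw [Subtype.isCompact_iff]
  convert hc using 1
  ext y
  simp only [mem_image, mem_preimage, mem_singleton_iff, Subtype.exists, Subtype.ext_iff,
    restrictPreimage_coe]
  constructor
  · rintro ⟨y, hy, h, rfl⟩
    exact h
  · intro h
    exact ⟨y, Eq.subst (motive := (· ∈ B)) h.symm hx, h, rfl⟩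

/-- Sublevel sets are saturated: `V` is constant on each Morse set, and Morse sets lie in the basin.
-/
theorem IsStrictMorseLyapunov.mk_mem_quotientSublevel (hV : IsStrictMorseLyapunov S 𝒜 M V c)
    (h𝒜 : IsAttractor S 𝒜) (hM : IsMorseDecomposition S 𝒜 M) {r : ℝ} {x : X} :
    Quot.mk (morseRel M) x ∈ quotientSublevel S 𝒜 M V r ↔
      x ∈ attractionBasin S 𝒜 ∧ V x ≤ r := by
  refine ⟨?_, fun h => mem_image_of_mem _ h⟩
  rintro ⟨y, ⟨hy, hyr⟩, h⟩
  rcases hM.mk_eq_mk_iff.1 h with rfl | ⟨k, hyk, hxk⟩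
  · exact ⟨hy, hyr⟩
  · refine ⟨subset_attractionBasin h𝒜.2.2.2.1 (hM.subset k hxk), ?_⟩
    rwa [hV.const k x hxk, ← hV.const k y hyk]

theorem IsStrictMorseLyapunov.quotientSublevel_eq_empty (hV : IsStrictMorseLyapunov S 𝒜 M V c)
    (h𝒜 : IsAttractor S 𝒜) (hM : IsMorseDecomposition S 𝒜 M) {r : ℝ} (hr : ∀ k, r < c k) :
    quotientSublevel S 𝒜 M V r = ∅ := by
  refine image_eq_empty.2 (eq_empty_iff_forall_notMem.2 fun x ⟨hx, hxr⟩ => ?_)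
  obtain ⟨k, hk, -⟩ := hV.exists_tendsto h𝒜 hM hx
  exact (hr k).not_ge (hk.trans hxr)

/-- The trajectories of all points of a sublevel set can be followed for times depending
continuously on the point until `V` is at most `a`. -/
theorem IsStrictMorseLyapunov.exists_descent_time (hV : IsStrictMorseLyapunov S 𝒜 M V c)
    (h𝒜 : IsAttractor S 𝒜) (hM : IsMorseDecomposition S 𝒜 M) {a b : ℝ}
    (hc : ∀ k, c k ∉ Icc a b) {Y : Set X} (hY : ∀ x ∈ Y, x ∈ attractionBasin S 𝒜 ∧ V x ≤ b) :
    ∃ τ : C(Y, ℝ), ∀ x : Y, V (S (τ x).toNNReal x) ≤ a := by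
  -- Partition of unity: admissible times form a convex set since `V` decreases along trajectories,
  -- and a time reaching `V < a` strictly works for all nearby points.
  refine exists_continuous_forall_mem_convex_of_local_const
    (t := fun x : Y => {t : ℝ | V (S t.toNNReal x) ≤ a}) (fun x => ?_) fun x => ?_
  · refine OrdConnected.convex ⟨fun s hs t _ r hr => ?_⟩
    exact (hV.antitone h𝒜 hM (hY x x.2).1 (Real.toNNReal_mono hr.1)).trans hs
  · obtain ⟨t, ht⟩ := hV.exists_flow_lt h𝒜 hM (a := a) (hY x x.2).1
      fun k hk => hc k ⟨hk.1, hk.2.trans (hY x x.2).2⟩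
    refine ⟨t, ?_⟩
    have hcont : Continuous fun y : Y => V (S t y) :=
      hV.continuousOn.comp_continuous ((S.continuous_toFun t).comp continuous_subtype_val)
        fun y => flow_mem_attractionBasin (hY y y.2).1 t
    filter_upwards [hcont.tendsto x |>.eventually_lt_const ht] with y hy
    simpa using hy.le

/-- If `[a, b]` contains no generalized critical value, `Ṽ_a` and `Ṽ_b` are homotopy equivalent. -/
theorem IsStrictMorseLyapunov.nonempty_homotopyEquiv_quotientSublevel
    (hV : IsStrictMorseLyapunov S 𝒜 M V c) (h𝒜 : IsAttractor S 𝒜)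
    (hM : IsMorseDecomposition S 𝒜 M) {a b : ℝ} (hab : a ≤ b) (hc : ∀ k, c k ∉ Icc a b) :
    Nonempty (ContinuousMap.HomotopyEquiv (quotientSublevel S 𝒜 M V a)
      (quotientSublevel S 𝒜 M V b)) := by
  set Q := quotientSublevel S 𝒜 M V b
  let f := Q.restrictPreimage (Quot.mk (morseRel M))
  have hf : IsProperMap f := hM.isProperMap_restrictPreimage h𝒜 Q
  have hsurj : Function.Surjective f := Quot.mk_surjective.restrictPreimage Q
  have hmem : ∀ {r : ℝ} {x : X}, Quot.mk (morseRel M) x ∈ quotientSublevel S 𝒜 M V r ↔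
      x ∈ attractionBasin S 𝒜 ∧ V x ≤ r := hV.mk_mem_quotientSublevel h𝒜 hM
  obtain ⟨τ, hτ⟩ := hV.exists_descent_time h𝒜 hM hc (Y := Quot.mk (morseRel M) ⁻¹' Q)
    fun x hx => hmem.1 hx
  -- A negative `τ` is truncated to time 0, where `V ≤ a` already holds.
  let h : I × (Quot.mk (morseRel M) ⁻¹' Q) → X := fun p => S (p.1 * τ p.2).toNNReal p.2
  have hh : Continuous h := by fun_prop
  have hhr : ∀ {r : ℝ} p, Quot.mk (morseRel M) p.2.1 ∈ quotientSublevel S 𝒜 M V r →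
      Quot.mk (morseRel M) (h p) ∈ quotientSublevel S 𝒜 M V r := by
    intro r p hp
    have hp' := hmem.1 hp
    exact hmem.2 ⟨flow_mem_attractionBasin hp'.1 _, (hV.le_of_flow h𝒜 hM hp'.1 _).trans hp'.2⟩
  let ρ := Function.surjInv hsurj
  have hρ : ∀ z, f (ρ z) = z := Function.surjInv_eq hsurj
  have hρ' : ∀ z, Quot.mk (morseRel M) (ρ z).1 = z.1 := fun z => congrArg Subtype.val (hρ z)
  let H : I × Q → Q := fun p => ⟨Quot.mk _ (h (p.1, ρ p.2)), hhr _ (ρ p.2).2⟩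
  -- The choice of representative `ρ` is harmless: points of one Morse set may flow for different
  -- times, yet they stay in that set and have the same class.
  have hH : ∀ s y, (H (s, f y) : MorseQuotient M) = Quot.mk _ (h (s, y)) := by
    intro s y
    rcases hM.mk_eq_mk_iff.1 (hρ' (f y)) with heq | ⟨k, h₁, h₂⟩
    · simp only [H, Subtype.ext heq]
    · exact hM.mk_eq_mk_iff.2 (Or.inr ⟨k, hM.flow_mem h𝒜 h₁ _, hM.flow_mem h𝒜 h₂ _⟩)
  have hHc : Continuous H := by
    -- Properness keeps the map closed, hence a quotient map, after taking the product with `I`.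
    have hq : IsQuotientMap (Prod.map id f : I × _ → I × Q) := by
      have hp : IsProperMap (Prod.map id f : I × _ → I × Q) := isProperMap_id.prodMap hf
      exact hp.isClosedMap.isQuotientMap hp.continuous (Function.surjective_id.prodMap hsurj)
    refine hq.continuous_iff.2 (continuous_induced_rng.2 ?_)
    refine (continuous_quot_mk.comp hh).congr fun p => ?_
    exact (hH p.1 p.2).symm
  refine nonempty_homotopyEquiv_of_deformation (image_mono fun x hx => ⟨hx.1, hx.2.trans hab⟩)
    ⟨H, hHc⟩ (fun z => Subtype.ext ?_) (fun z => ?_) fun s z hz => ?_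
  · simp [H, h, hρ']
  · refine hmem.2 ⟨flow_mem_attractionBasin (hmem.1 (ρ z).2).1 _, ?_⟩
    simpa [h] using hτ (ρ z)
  · refine hhr _ ?_
    rwa [hρ']

end Deformation

/-! ### Chaining the levels and summing the exact sequences. -/

noncomputable section MorseInequalities

open CategoryTheory Cardinal

variable {X : Type u} [MetricSpace X] {S : Flow ℝ≥0 X}
  {𝒜 : Set X} {l : ℕ} {M : Fin l → Set X} {V : X → ℝ} {c : Fin l → ℝ}
  (R : Type v) [CommRing R] (G : Type u) [AddCommGroup G] [Module R G]

/-- The homology of `Ṽ_r` does not change as long as `r` crosses no generalized critical value. -/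
theorem IsStrictMorseLyapunov.nonempty_iso_quotientSublevel
    (hV : IsStrictMorseLyapunov S 𝒜 M V c) (h𝒜 : IsAttractor S 𝒜)
    (hM : IsMorseDecomposition S 𝒜 M) {r s : ℝ} (h : ∀ k, c k ∉ uIcc r s) (q : ℕ) :
    Nonempty (singularHomologyGroup R G (quotientSublevel S 𝒜 M V r) q ≅
      singularHomologyGroup R G (quotientSublevel S 𝒜 M V s) q) := by
  rcases le_total r s with hrs | hrs
  · rw [uIcc_of_le hrs] at h
    obtain ⟨e⟩ := hV.nonempty_homotopyEquiv_quotientSublevel h𝒜 hM hrs h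
    exact nonempty_iso_singularHomologyGroup R G e q
  · rw [uIcc_of_ge hrs] at h
    obtain ⟨e⟩ := hV.nonempty_homotopyEquiv_quotientSublevel h𝒜 hM hrs h
    exact nonempty_iso_singularHomologyGroup R G e.symm q

theorem IsStrictMorseLyapunov.rank_quotientSublevel_eq
    (hV : IsStrictMorseLyapunov S 𝒜 M V c) (h𝒜 : IsAttractor S 𝒜)
    (hM : IsMorseDecomposition S 𝒜 M) {r s : ℝ} (h : ∀ k, c k ∉ uIcc r s) (q : ℕ) :
    Module.rank R (singularHomologyGroup R G (quotientSublevel S 𝒜 M V r) q) =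
      Module.rank R (singularHomologyGroup R G (quotientSublevel S 𝒜 M V s) q) := by
  obtain ⟨e⟩ := hV.nonempty_iso_quotientSublevel R G h𝒜 hM h q
  exact e.toLinearEquiv.rank_eq

/-- A subset `P ⊆ Q`, regarded as a subspace of the subspace `Q`, has the homology of `P`. -/
theorem rank_singularHomologyGroup_preimage_val {Z : Type u} [TopologicalSpace Z] {P Q : Set Z}
    (hPQ : P ⊆ Q) (q : ℕ) :
    Module.rank R (singularHomologyGroup R G (Subtype.val ⁻¹' P : Set Q) q) =
      Module.rank R (singularHomologyGroup R G P q) := by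
  let e : (Subtype.val ⁻¹' P : Set Q) ≃ₜ P :=
    { toFun := fun z => ⟨z.1.1, z.2⟩
      invFun := fun z => ⟨⟨z.1, hPQ z.2⟩, z.2⟩
      left_inv := fun _ => rfl
      right_inv := fun _ => rfl
      continuous_toFun := by fun_prop
      continuous_invFun := by fun_prop }
  obtain ⟨e'⟩ := nonempty_iso_singularHomologyGroup R G e.toHomotopyEquiv q
  exact e'.toLinearEquiv.rank_eq

/-- Noncritical levels separating the generalized critical values: `r` below all of them, and `b k`
just above `c k`. -/
def separatingLevel (r : ℝ) (b : Fin l → ℝ) : Fin (l + 1) → ℝ :=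
  Fin.cases r b

/-- With `separatingLevel_lt`: level `i` has exactly the `c j` with `j < i` below it. -/
theorem lt_separatingLevel (hc : StrictMono c) {r : ℝ} {b : Fin l → ℝ} (hb : ∀ k, c k < b k)
    {i : Fin (l + 1)} {j : Fin l} (hij : j.castSucc < i) : c j < separatingLevel r b i := by
  rcases Fin.eq_zero_or_eq_succ i with rfl | ⟨m, rfl⟩
  · exact absurd hij (Fin.not_lt_zero _)
  · exact (hc.monotone (Fin.castSucc_lt_succ_iff.1 hij)).trans_lt (hb m)

theorem separatingLevel_lt (hc : StrictMono c) {a b : Fin l → ℝ}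
    (hab : ∀ k, a k < c k ∧ c k < b k ∧ ∀ j, c j ∈ Icc (a k) (b k) → j = k) {r : ℝ}
    (hr : ∀ k, r < c k) {i : Fin (l + 1)} {j : Fin l} (hij : i ≤ j.castSucc) :
    separatingLevel r b i < c j := by
  rcases Fin.eq_zero_or_eq_succ i with rfl | ⟨m, rfl⟩
  · exact hr j
  · have hmj : m < j := Fin.succ_le_castSucc_iff.1 hij
    change b m < c j
    by_contra! hle
    exact hmj.ne' ((hab m).2.2 j ⟨(hab m).1.le.trans (hc.monotone hmj.le), hle⟩)

/-- The bottom of the `k`-th pair and the top of the previous one (or `r`) lie in the same gap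
between consecutive critical values, in either order; this links the pairs into a chain. -/
theorem notMem_uIcc_separatingLevel_castSucc (hc : StrictMono c) {a b : Fin l → ℝ}
    (hab : ∀ k, a k < c k ∧ c k < b k ∧ ∀ j, c j ∈ Icc (a k) (b k) → j = k) {r : ℝ}
    (hr : ∀ k, r < c k) (k j : Fin l) :
    c j ∉ uIcc (a k) (separatingLevel r b k.castSucc) := by
  intro hj
  rcases mem_uIcc.1 hj with ⟨h₁, h₂⟩ | ⟨h₁, h₂⟩
  · have hjk := h₂.trans_lt (separatingLevel_lt hc hab hr le_rfl)
    exact hjk.ne (congrArg c ((hab k).2.2 j ⟨h₁, hjk.le.trans (hab k).2.1.le⟩))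
  · have hjk : j < k := hc.lt_iff_lt.1 (h₂.trans_lt (hab k).1)
    exact h₁.not_gt
      (lt_separatingLevel hc (fun k => (hab k).2.1) (Fin.castSucc_lt_castSucc_iff.2 hjk))

/-- The ranks of the homology of the sublevel sets and the quotient critical groups satisfy the
relations from which the Morse inequalities follow. -/
theorem IsStrictMorseLyapunov.exists_rank_relations [IsDomain R]
    (hV : IsStrictMorseLyapunov S 𝒜 M V c) (h𝒜 : IsAttractor S 𝒜)
    (hM : IsMorseDecomposition S 𝒜 M) {a b : Fin l → ℝ}
    (hab : ∀ k, a k < c k ∧ c k < b k ∧ ∀ j, c j ∈ Icc (a k) (b k) → j = k)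
    {b' : ℝ} (hb' : ∀ k, c k < b')
    (hfin : ∀ k q, Module.rank R (quotientCriticalGroup R G S 𝒜 M V (a k) (b k) q) < ℵ₀) :
    (∀ q, Module.rank R (singularHomologyGroup R G (quotientSublevel S 𝒜 M V b') q) < ℵ₀) ∧
    ∃ E : ℕ → ℕ,
      quotientMorseTypeNumber R G S 𝒜 M V a b 0 = quotientBettiNumber R G S 𝒜 M V b' 0 + E 0 ∧
      ∀ q, quotientMorseTypeNumber R G S 𝒜 M V a b (q + 1) =
        E q + quotientBettiNumber R G S 𝒜 M V b' (q + 1) + E (q + 1) := by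
  obtain ⟨r, hr⟩ : ∃ r : ℝ, ∀ k, r < c k := by
    obtain ⟨r, hr⟩ := (finite_range c).bddBelow
    exact ⟨r - 1, fun k => by linarith [hr (mem_range_self k)]⟩
  let L := separatingLevel r b
  let H : Fin (l + 1) → ℕ → ModuleCat.{u} R := fun i q =>
    singularHomologyGroup R G (quotientSublevel S 𝒜 M V (L i)) q
  have hsub : ∀ k, quotientSublevel S 𝒜 M V (a k) ⊆ quotientSublevel S 𝒜 M V (b k) := fun k =>
    image_mono fun x hx => ⟨hx.1, hx.2.trans ((hab k).1.trans (hab k).2.1).le⟩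
  have hlow : ∀ k q, Module.rank R (singularHomologyGroup R G
      (Subtype.val ⁻¹' quotientSublevel S 𝒜 M V (a k) : Set (quotientSublevel S 𝒜 M V (b k))) q) =
      Module.rank R (H k.castSucc q) := fun k q =>
    (rank_singularHomologyGroup_preimage_val R G (hsub k) q).trans <|
      hV.rank_quotientSublevel_eq R G h𝒜 hM
        (notMem_uIcc_separatingLevel_castSucc hV.strict hab hr k) q
  have hbot : ∀ q, Module.rank R (H 0 q) = 0 := by
    intro q
    have : IsEmpty (quotientSublevel S 𝒜 M V r) :=
      isEmpty_coe_sort.2 (hV.quotientSublevel_eq_empty h𝒜 hM hr)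
    exact rank_singularHomologyGroup_of_isEmpty R G (quotientSublevel S 𝒜 M V r) q
  have htop : ∀ q, Module.rank R (H (Fin.last l) q) =
      Module.rank R (singularHomologyGroup R G (quotientSublevel S 𝒜 M V b') q) := by
    refine hV.rank_quotientSublevel_eq R G h𝒜 hM fun k hk => ?_
    have hkL : c k < L (Fin.last l) :=
      lt_separatingLevel hV.strict (fun k => (hab k).2.1) (Fin.castSucc_lt_last k)
    rcases (mem_uIcc.1 hk) with h | h
    · exact h.1.not_gt hkL
    · exact h.1.not_gt (hb' k)
  -- Finiteness climbs the levels: each group sits between the previous level's homology and a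
  -- critical group.
  have hH : ∀ i q, Module.rank R (H i q) < ℵ₀ := by
    intro i
    induction i using Fin.induction with
    | zero => exact fun q => (hbot q).trans_lt aleph0_pos
    | succ k ih =>
      exact fun q => rank_singularHomologyGroup_lt_aleph0 R G _ _ q ((hlow k q).trans_lt (ih q))
        (hfin k q)
  choose d hd₀ hd using fun k => exists_rank_connecting R G (quotientSublevel S 𝒜 M V (b k))
    (Subtype.val ⁻¹' quotientSublevel S 𝒜 M V (a k)) (fun q => (hlow k q).trans_lt (hH _ q))
    (hfin k)
  have hsum : ∀ q, quotientMorseTypeNumber R G S 𝒜 M V a b q +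
      ∑ k : Fin l, Module.finrank R (H k.castSucc q) =
      ∑ k : Fin l, (Module.finrank R (quotientCriticalGroup R G S 𝒜 M V (a k) (b k) q) +
        Module.finrank R (singularHomologyGroup R G (Subtype.val ⁻¹'
          quotientSublevel S 𝒜 M V (a k) : Set (quotientSublevel S 𝒜 M V (b k))) q)) := by
    intro q
    rw [Finset.sum_add_distrib]
    exact congrArg _ (Finset.sum_congr rfl fun k _ => congrArg Cardinal.toNat (hlow k q).symm)
  -- The two sums differ only in the top level, which is `β̃_q`, and the bottom one, which is 0.
  have htel : ∀ q, ∑ k : Fin l, Module.finrank R (H k.succ q) =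
      ∑ k : Fin l, Module.finrank R (H k.castSucc q) + quotientBettiNumber R G S 𝒜 M V b' q := by
    intro q
    have h := (Fin.sum_univ_succ fun i => Module.finrank R (H i q)).symm.trans
      (Fin.sum_univ_castSucc fun i => Module.finrank R (H i q))
    have h0 : Module.finrank R (H 0 q) = 0 := by simp [Module.finrank, hbot q]
    rw [h0, zero_add] at h
    rw [h]
    exact congrArg _ (congrArg Cardinal.toNat (htop q))
  refine ⟨fun q => htop q ▸ hH _ q, fun q => ∑ k, d k q, ?_, fun q => ?_⟩
  · have h := (hsum 0).trans (Finset.sum_congr rfl fun k _ => hd₀ k)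
    have h' : quotientMorseTypeNumber R G S 𝒜 M V a b 0 +
        ∑ k : Fin l, Module.finrank R (H k.castSucc 0) =
        ∑ k : Fin l, Module.finrank R (H k.succ 0) + ∑ k, d k 0 :=
      h.trans Finset.sum_add_distrib
    have := htel 0
    dsimp only
    omega
  · have h := (hsum (q + 1)).trans (Finset.sum_congr rfl fun k _ => hd k q)
    have h' : quotientMorseTypeNumber R G S 𝒜 M V a b (q + 1) +
        ∑ k : Fin l, Module.finrank R (H k.castSucc (q + 1)) =
        ∑ k, d k q + ∑ k : Fin l, Module.finrank R (H k.succ (q + 1)) + ∑ k, d k (q + 1) :=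
      h.trans (Finset.sum_add_distrib.trans (congrArg (· + _) Finset.sum_add_distrib))
    have := htel (q + 1)
    dsimp only
    omega

end MorseInequalities

theorem mainTheorem10 {X : Type u} [MetricSpace X] [CompleteSpace X]
    (S : Flow ℝ≥0 X) (hS : AsymptoticallyCompact S)
    (𝒜 : Set X) (h𝒜 : IsAttractor S 𝒜)
    {l : ℕ} (M : Fin l → Set X) (hM : IsMorseDecomposition S 𝒜 M)
    (V : X → ℝ) (c : Fin l → ℝ) (hV : IsStrictMorseLyapunov S 𝒜 M V c)
    (R : Type v) [CommRing R] [IsDomain R] (G : Type u) [AddCommGroup G] [Module R G]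
    (a b : Fin l → ℝ)
    (hab : ∀ k, a k < c k ∧ c k < b k ∧ ∀ j, c j ∈ Set.Icc (a k) (b k) → j = k)
    (b' : ℝ) (hb' : ∀ k, c k < b')
    (hfin : ∀ k q,
      Module.rank R (quotientCriticalGroup R G S 𝒜 M V (a k) (b k) q) < Cardinal.aleph0) :
    (∀ q, Module.rank R (singularHomologyGroup R G (quotientSublevel S 𝒜 M V b') q) <
      Cardinal.aleph0) ∧
    (∀ q : ℕ,
      ∑ j ∈ Finset.range (q + 1), (-1 : ℤ) ^ (q - j) * (quotientBettiNumber R G S 𝒜 M V b' j : ℤ) ≤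
      ∑ j ∈ Finset.range (q + 1),
        (-1 : ℤ) ^ (q - j) * (quotientMorseTypeNumber R G S 𝒜 M V a b j : ℤ)) ∧
    (∀ s : ℝ,
      Tendsto (fun n : ℕ => ∑ q ∈ Finset.range n,
        (-1 : ℝ) ^ q * (quotientMorseTypeNumber R G S 𝒜 M V a b q : ℝ)) atTop (𝓝 s) →
      Tendsto (fun n : ℕ => ∑ q ∈ Finset.range n,
        (-1 : ℝ) ^ q * (quotientBettiNumber R G S 𝒜 M V b' q : ℝ)) atTop (𝓝 s)) := by
  obtain ⟨hβ, E, h0, hsucc⟩ := hV.exists_rank_relations R G h𝒜 hM hab hb' hfin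
  exact ⟨hβ, alternating_sum_le _ _ E h0 hsucc, fun s => tendsto_alternating_sum _ _ E h0 hsucc⟩
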